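/- Let $n\in\mathbb N$. For positive definite $A,B\in M_n(\mathbb C)$ and $s\in[0,1]$ let $A\#_sB=A^{1/2}(A^{-1/2}BA^{-1/2})^sA^{1/2}$ be the weighted geometric mean. For $k,t\in(0,1)$ put $$F_{k,t}(A,B)=(A^{-1}\#_kB)^t\,A^{1+2t-4kt}\,(A^{-1}\#_kB)^t,$$ $$A\natural_tB=(A^{-1}\#_{1/2}B)^t\,A\,(A^{-1}\#_{1/2}B)^t,\qquad A\,\widetilde\natural_k\,B=(A^{-1}\#_kB)^{1/2}A^{2(1-k)}(A^{-1}\#_kB)^{1/2}.$$ For positive semidefinite $X,Y\in M_n(\mathbb C)$ with eigenvalues $\lambda_1\ge\dots\ge\lambda_n$ listed with multiplicity, write $X\prec_{(\log)}Y$ ($X$ is log-majorized by $Y$) if $\prod_{i=1}^j\lambda_i(X)\le\prod_{i=1}^j\lambda_i(Y)$ for $j=1,\dots,n$, with equality for $j=n$. Then for all positive definite $A,B\in M_n(\mathbb C)$ the following hold. 1. If $k,t\in(0,\tfrac12]$ and $L=1+2t-4kt$, then $F_{k,t}(A^q,B^q)^{1/q}\prec_{(\log)}F_{k,t}(A^p,B^p)^{1/p}$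 for all real $p,q$ with $0<q\le\frac{2ktL}{1-2kt}\,p$. 2. If $t\in(0,1)$, then $(A^q\natural_tB^q)^{1/q}\prec_{(\log)}(A^p\natural_tB^p)^{1/p}$ for all real $p,q$ with $0<q\le\min\{\frac t{1-t},\frac{1-t}t\}\,p$. 3. If $k\in(0,\tfrac12]$, then $(A^q\,\widetilde\natural_k\,B^q)^{1/q}\prec_{(\log)}(A^p\,\widetilde\natural_k\,B^p)^{1/p}$ for all real $p,q$ with $0<q\le 2kp$. -/

import Mathlib

open scoped ComplexOrder MatrixOrder Matrix.Norms.L2Operator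

/- Throughout, `A ^ (r : ℝ)` for a matrix `A` is Mathlib's `CFC.rpow`, the real power of a positive
matrix by functional calculus. -/

section SpectralGeometricMeans

variable {ι : Type*} [Fintype ι] [DecidableEq ι]

/-- The weighted geometric mean `A #_s B = A^{1/2} (A^{-1/2} B A^{-1/2})^s A^{1/2}`. -/
noncomputable def weightedGeomMean (s : ℝ) (A B : Matrix ι ι ℂ) : Matrix ι ι ℂ :=
  A ^ (1 / 2 : ℝ) * (A ^ (-(1 / 2) : ℝ) * B * A ^ (-(1 / 2) : ℝ)) ^ s * A ^ (1 / 2 : ℝ)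

/-- The `(k, t)`-spectral geometric mean
`F_{k,t}(A, B) = (A⁻¹ #_k B)^t A^{1+2t-4kt} (A⁻¹ #_k B)^t`. -/
noncomputable def spectralGeomMeanKT (k t : ℝ) (A B : Matrix ι ι ℂ) : Matrix ι ι ℂ :=
  weightedGeomMean k A⁻¹ B ^ t * A ^ (1 + 2 * t - 4 * k * t) * weightedGeomMean k A⁻¹ B ^ t

/-- The weighted spectral geometric mean `A ♮_t B = (A⁻¹ # B)^t A (A⁻¹ # B)^t`. -/
noncomputable def spectralGeomMean (t : ℝ) (A B : Matrix ι ι ℂ) : Matrix ι ι ℂ :=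
  weightedGeomMean (1 / 2) A⁻¹ B ^ t * A * weightedGeomMean (1 / 2) A⁻¹ B ^ t

/-- The weighted spectral geometric mean
`A ♮~_k B = (A⁻¹ #_k B)^{1/2} A^{2(1-k)} (A⁻¹ #_k B)^{1/2}`. -/
noncomputable def spectralGeomMeanTilde (k : ℝ) (A B : Matrix ι ι ℂ) : Matrix ι ι ℂ :=
  weightedGeomMean k A⁻¹ B ^ (1 / 2 : ℝ) * A ^ (2 * (1 - k)) *
    weightedGeomMean k A⁻¹ B ^ (1 / 2 : ℝ)

/-- The product `λ₁(A) ⋯ λ_j(A)` of the `j` largest eigenvalues of a Hermitian matrix, counted with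
multiplicity (`eigenvalues₀` lists all the eigenvalues in decreasing order). -/
noncomputable def eigenvalueProd {A : Matrix ι ι ℂ} (hA : A.IsHermitian) (j : ℕ) : ℝ :=
  ∏ i : Fin (Fintype.card ι) with i.val < j, hA.eigenvalues₀ i

/-- Log-majorization `A ≺_(log) B`: both matrices are positive semidefinite,
`λ₁(A) ⋯ λ_j(A) ≤ λ₁(B) ⋯ λ_j(B)` for `j = 1, …, n`, with equality for `j = n`. -/
def LogMajorizedBy (A B : Matrix ι ι ℂ) : Prop :=
  ∃ (hA : A.PosSemidef) (hB : B.PosSemidef),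
    (∀ j : ℕ, 1 ≤ j → j ≤ Fintype.card ι →
      eigenvalueProd hA.isHermitian j ≤ eigenvalueProd hB.isHermitian j) ∧
    eigenvalueProd hA.isHermitian (Fintype.card ι) =
      eigenvalueProd hB.isHermitian (Fintype.card ι)

end SpectralGeometricMeans

/-! Write `c = a⁻¹`, `g = c #_k b`, `l = 1 + 2t - 4kt` and `d = 2ktl / (1 - 2kt)`. Compound matrices
turn log-majorization into a single operator inequality: the compound map is multiplicative and
commutes with real powers, hence with `F_{k,t}`, and the largest eigenvalue of the `j`-th compound
of a positive matrix is the product of its `j` largest eigenvalues. Equality at `j = n` is a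
determinant computation.

It remains to show that `F_{k,t}(a, b) ≤ γ` forces `F_{k,t}(a^r, b^r) ≤ γ^r` for `0 < r ≤ d`.
Homogeneity in `b` reduces this to `γ = 1`, where `F_{k,t}(a, b) ≤ 1` means `g^{2t} ≤ c^l`. The
grand Furuta inequality recovers `b` from `c` and `g` and gives `b^d ≤ c^l`
(`rpow_le_of_spectralMean_le_one`); Löwner–Heinz and monotonicity of the mean then lead back to the
same condition for `a^r, b^r` (`spectralMean_rpow_le_one`).

The other two means are the cases `k = 1/2` and `t = 1/2`; for `A ♮_t B` with `t ≥ 1/2` the symmetry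
`A ♮_t B = B ♮_{1-t} A` is used. -/

section CStarAlgebra

variable {𝒜 : Type*} [CStarAlgebra 𝒜] [PartialOrder 𝒜] [StarOrderedRing 𝒜]

/-! ### Real powers of strictly positive elements -/

theorem rpow_mul_rpow {a : 𝒜} (ha : IsStrictlyPositive a) (x y : ℝ) :
    a ^ x * a ^ y = a ^ (x + y) :=
  (CFC.rpow_add ha.isUnit).symm

theorem rpow_mul_rpow_mul {a : 𝒜} (ha : IsStrictlyPositive a) (x y : ℝ) (c : 𝒜) :
    a ^ x * (a ^ y * c) = a ^ (x + y) * c := by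
  rw [← mul_assoc, rpow_mul_rpow ha]

theorem rpow_rpow {a : 𝒜} (ha : IsStrictlyPositive a) (x y : ℝ) : (a ^ x) ^ y = a ^ (x * y) := by
  rcases eq_or_ne x 0 with rfl | hx
  · rw [zero_mul, CFC.rpow_zero a ha.nonneg, CFC.one_rpow]
  · exact CFC.rpow_rpow a x y hx ha

theorem star_rpow (a : 𝒜) (x : ℝ) : star (a ^ x) = a ^ x :=
  CFC.rpow_nonneg.isSelfAdjoint.star_eq

theorem IsStrictlyPositive.rpow_conj {a b : 𝒜} (ha : IsStrictlyPositive a)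
    (hb : IsStrictlyPositive b) (x : ℝ) : IsStrictlyPositive (a ^ x * b * a ^ x) := by
  rw [IsStrictlyPositive.iff_of_unital]
  refine ⟨?_, ((ha.isUnit.cfcRpow x ha.nonneg).mul hb.isUnit).mul
    (ha.isUnit.cfcRpow x ha.nonneg)⟩
  simpa [star_rpow] using star_left_conjugate_nonneg hb.nonneg (a ^ x)

theorem rpow_conj_le {b c : 𝒜} (a : 𝒜) (x : ℝ) (h : b ≤ c) :
    a ^ x * b * a ^ x ≤ a ^ x * c * a ^ x := by
  simpa [star_rpow] using star_left_conjugate_le_conjugate h (a ^ x)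

theorem unitary_conj_rpow (u : unitary 𝒜) {a : 𝒜} (ha : IsStrictlyPositive a) (s : ℝ) :
    ((u : 𝒜) * a * star (u : 𝒜)) ^ s = u * a ^ s * star (u : 𝒜) := by
  have hpos : 0 ≤ (u : 𝒜) * a * star (u : 𝒜) := by
    simpa using star_left_conjugate_nonneg ha.nonneg (star (u : 𝒜))
  rw [CFC.rpow_eq_cfc_real (a := a) ha.nonneg, CFC.rpow_eq_cfc_real hpos]
  refine (StarAlgHomClass.map_cfc (S := ℝ) (Unitary.conjStarAlgAut ℝ 𝒜 u) (fun x : ℝ ↦ x ^ s) a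
    (hf := ?_) (hφ := ?_) ha.nonneg.isSelfAdjoint hpos.isSelfAdjoint).symm
  · refine ContinuousOn.rpow_const continuousOn_id fun x hx ↦ Or.inl ?_
    rintro rfl
    exact spectrum.zero_notMem ℝ ha.isUnit hx
  · change Continuous fun x ↦ (u : 𝒜) * x * star (u : 𝒜)
    fun_prop

/-- `x f(x⋆x) x⋆ = x x⋆ f(x x⋆)` for power functions `f` and invertible `x`. -/
theorem mul_rpow_mul_star {x : 𝒜} (hx : IsUnit x) (s : ℝ) :
    x * (star x * x) ^ s * star x = (x * star x) ^ (s + 1) := by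
  have hh : IsStrictlyPositive (star x * x) :=
    (IsStrictlyPositive.iff_of_unital).2 ⟨star_mul_self_nonneg x, hx.star.mul hx⟩
  set h := star x * x with hdef
  have hu1 : star (x * h ^ (-(1 / 2) : ℝ)) * (x * h ^ (-(1 / 2) : ℝ)) = 1 := by
    have : star (x * h ^ (-(1 / 2) : ℝ)) * (x * h ^ (-(1 / 2) : ℝ))
        = h ^ (-(1 / 2) : ℝ) * h ^ (1 : ℝ) * h ^ (-(1 / 2) : ℝ) := by
      rw [CFC.rpow_one h hh.nonneg, star_mul, star_rpow, hdef]
      simp only [mul_assoc]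
    rw [this, rpow_mul_rpow hh, rpow_mul_rpow hh]
    norm_num
    exact CFC.rpow_zero h hh.nonneg
  have huu : IsUnit (x * h ^ (-(1 / 2) : ℝ)) := hx.mul (hh.isUnit.cfcRpow _ hh.nonneg)
  -- The unitary factor of the polar decomposition `x = u h^{1/2}`; conjugation by it carries `x⋆x`
  -- to `xx⋆`.
  let u : unitary 𝒜 := ⟨x * h ^ (-(1 / 2) : ℝ), hu1, by
    rw [← huu.mul_left_inj, mul_assoc, hu1, mul_one, one_mul]⟩
  have key (r : ℝ) : (u : 𝒜) * h ^ r * star (u : 𝒜) = x * h ^ (r - 1) * star x := by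
    simp only [u, star_mul, star_rpow, mul_assoc, rpow_mul_rpow_mul hh]
    ring_nf
  have h1 : (u : 𝒜) * h * star (u : 𝒜) = x * star x := by
    have := key 1
    rw [CFC.rpow_one h hh.nonneg, sub_self, CFC.rpow_zero h hh.nonneg, mul_one] at this
    exact this
  rw [← h1, unitary_conj_rpow u hh, key, add_sub_cancel_right]

/-- The operator `a ♮_s b = a^{1/2} (a^{-1/2} b a^{-1/2})^s a^{1/2}` for an arbitrary real `s`. -/
noncomputable def powMean (s : ℝ) (a b : 𝒜) : 𝒜 :=
  a ^ (1 / 2 : ℝ) * (a ^ (-(1 / 2) : ℝ) * b * a ^ (-(1 / 2) : ℝ)) ^ s * a ^ (1 / 2 : ℝ)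

variable {a b : 𝒜}

theorem IsStrictlyPositive.powMean (ha : IsStrictlyPositive a) (hb : IsStrictlyPositive b)
    (s : ℝ) : IsStrictlyPositive (powMean s a b) :=
  ha.rpow_conj ((ha.rpow_conj hb _).rpow _ s) _

/-- This is `mul_rpow_mul_star` for `x = a^{-1/2} b^{1/2}`. The inner exponent drops to `s - 1`, so
`s ∈ [1, 2]` comes within reach of Löwner–Heinz. -/
theorem powMean_eq_flip (ha : IsStrictlyPositive a) (hb : IsStrictlyPositive b) (s : ℝ) :
    powMean s a b = b ^ (1 / 2 : ℝ) *
      (b ^ (1 / 2 : ℝ) * a ^ (-1 : ℝ) * b ^ (1 / 2 : ℝ)) ^ (s - 1) * b ^ (1 / 2 : ℝ) := by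
  have hx : IsUnit (a ^ (-(1 / 2) : ℝ) * b ^ (1 / 2 : ℝ)) :=
    (ha.isUnit.cfcRpow _ ha.nonneg).mul (hb.isUnit.cfcRpow _ hb.nonneg)
  have h := mul_rpow_mul_star hx (s - 1)
  have e1 : star (a ^ (-(1 / 2) : ℝ) * b ^ (1 / 2 : ℝ)) * (a ^ (-(1 / 2) : ℝ) * b ^ (1 / 2 : ℝ))
      = b ^ (1 / 2 : ℝ) * a ^ (-1 : ℝ) * b ^ (1 / 2 : ℝ) := by
    simp only [star_mul, star_rpow, mul_assoc, rpow_mul_rpow_mul ha]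
    norm_num
  have e2 : a ^ (-(1 / 2) : ℝ) * b ^ (1 / 2 : ℝ) * star (a ^ (-(1 / 2) : ℝ) * b ^ (1 / 2 : ℝ))
      = a ^ (-(1 / 2) : ℝ) * b * a ^ (-(1 / 2) : ℝ) := by
    simp only [star_mul, star_rpow, mul_assoc, rpow_mul_rpow_mul hb]
    norm_num
    rw [CFC.rpow_one b hb.nonneg]
  rw [e1, e2, sub_add_cancel] at h
  rw [powMean, ← h]
  simp only [star_mul, star_rpow, mul_assoc, rpow_mul_rpow_mul ha, rpow_mul_rpow ha]
  norm_num
  simp [CFC.rpow_zero a ha.nonneg]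

theorem powMean_powMean (ha : IsStrictlyPositive a) (hb : IsStrictlyPositive b)
    (s r : ℝ) : powMean r a (powMean s a b) = powMean (s * r) a b := by
  have h : a ^ (-(1 / 2) : ℝ) * powMean s a b * a ^ (-(1 / 2) : ℝ)
      = (a ^ (-(1 / 2) : ℝ) * b * a ^ (-(1 / 2) : ℝ)) ^ s := by
    simp only [powMean, mul_assoc, rpow_mul_rpow_mul ha, rpow_mul_rpow ha]
    norm_num
    simp [CFC.rpow_zero a ha.nonneg]
  rw [powMean, h, rpow_rpow (ha.rpow_conj hb _), ← powMean]

theorem powMean_one (ha : IsStrictlyPositive a) (hb : IsStrictlyPositive b) :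
    powMean 1 a b = b := by
  rw [powMean, CFC.rpow_one _ (ha.rpow_conj hb _).nonneg]
  simp only [mul_assoc, rpow_mul_rpow_mul ha, rpow_mul_rpow ha]
  norm_num
  simp [CFC.rpow_zero a ha.nonneg]

theorem powMean_rpow_rpow (ha : IsStrictlyPositive a) (x y s : ℝ) :
    powMean s (a ^ x) (a ^ y) = a ^ (x * (1 - s) + y * s) := by
  rw [powMean, rpow_rpow ha, rpow_rpow ha, rpow_mul_rpow ha, rpow_mul_rpow ha, rpow_rpow ha,
    rpow_mul_rpow ha, rpow_mul_rpow ha]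
  ring_nf

/-! ### Löwner–Heinz monotonicity and the grand Furuta inequality -/

theorem powMean_le_powMean_right {s : ℝ} (hs : s ∈ Set.Icc (0 : ℝ) 1) (a : 𝒜) {b c : 𝒜}
    (h : b ≤ c) : powMean s a b ≤ powMean s a c :=
  rpow_conj_le a _ (CFC.rpow_le_rpow hs (rpow_conj_le a _ h))

theorem rpow_neg_le_rpow_neg (hb : IsStrictlyPositive b) (h : b ≤ a) {t : ℝ}
    (ht : t ∈ Set.Icc (0 : ℝ) 1) : a ^ (-t) ≤ b ^ (-t) := by
  have ha : IsStrictlyPositive a := hb.of_le h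
  have := CFC.rpow_le_rpow ht (CStarAlgebra.rpow_neg_one_le_rpow_neg_one h hb)
  rwa [rpow_rpow ha, rpow_rpow hb,
    neg_one_mul] at this

/-- After the flip, `a^{-t} ≤ b^{-t}` can be inserted under the operator monotone power `s - 1 ∈ [0,
1]`; what remains consists of powers of `b` alone. -/
theorem powMean_rpow_le (hb : IsStrictlyPositive b) (h : b ≤ a) {t s : ℝ}
    (ht : t ∈ Set.Icc (0 : ℝ) 1) (hs : s ∈ Set.Icc (1 : ℝ) 2) (p : ℝ) :
    powMean s (a ^ t) (b ^ p) ≤ b ^ ((p - t) * s + t) := by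
  have ha : IsStrictlyPositive a := hb.of_le h
  rw [powMean_eq_flip (ha.rpow _ t) (hb.rpow _ p), rpow_rpow ha]
  have h1 : a ^ (t * -1) ≤ b ^ (-t) := by simpa using rpow_neg_le_rpow_neg hb h ht
  refine (rpow_conj_le _ _ (CFC.rpow_le_rpow (p := s - 1) ⟨by linarith [hs.1], by linarith [hs.2]⟩
    (rpow_conj_le (b ^ p) _ h1))).trans_eq ?_
  rw [rpow_rpow hb, rpow_mul_rpow hb, rpow_mul_rpow hb, rpow_rpow hb, rpow_mul_rpow hb,
    rpow_mul_rpow hb]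
  ring_nf

theorem one_le_exponent {t p s : ℝ} (ht : t ≤ 1) (hp : 1 ≤ p) (hs : 1 ≤ s) :
    1 ≤ (p - t) * s + t := by
  nlinarith [mul_nonneg (sub_nonneg.2 (ht.trans hp)) (sub_nonneg.2 hs)]

/-- A form of the grand Furuta inequality: if `0 < b ≤ a`, then
`(a^t ♮_s b^p)^{1 / ((p - t) s + t)} ≤ b` for `t ∈ [0, 1]` and `p, s ≥ 1`. -/
theorem powMean_rpow_rpow_inv_le {t : ℝ} (ht : t ∈ Set.Icc (0 : ℝ) 1) (n : ℕ) :
    ∀ {b : 𝒜} {p s : ℝ}, IsStrictlyPositive b → b ≤ a → 1 ≤ p → 1 ≤ s → s ≤ 2 ^ n →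
      powMean s (a ^ t) (b ^ p) ^ ((p - t) * s + t)⁻¹ ≤ b := by
  induction n with
  | zero =>
    intro b p s hb h hp hs hs2
    obtain rfl : s = 1 := le_antisymm (by simpa using hs2) hs
    rw [powMean_one ((hb.of_le h).rpow _ _) (hb.rpow _ _), rpow_rpow hb, mul_one, sub_add_cancel,
      mul_inv_cancel₀ (by positivity), CFC.rpow_one b hb.nonneg]
  | succ n ih =>
    intro b p s hb h hp hs hs2
    have ha := hb.of_le h
    -- Factor `s = r · (s / r)` with `r ∈ [1, 2]`: the step `r` is direct and yields `c ≤ b ≤ a`.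
    -- The induction hypothesis handles `s / r ≤ 2 ^ n` with `c` in place of `b` and `(p - t) r + t`
    -- in place of `p`.
    set r := min s 2 with hr
    have hr1 : 1 ≤ r := le_min hs one_le_two
    have hr0 : 0 < r := by positivity
    have he := one_le_exponent ht.2 hp hr1
    set c := powMean r (a ^ t) (b ^ p) ^ ((p - t) * r + t)⁻¹ with hc
    have hm := (ha.rpow _ t).powMean (hb.rpow _ p) r
    have hc0 : IsStrictlyPositive c := hm.rpow _ _
    have hcb : c ≤ b := by
      refine (CFC.rpow_le_rpow ⟨by positivity, inv_le_one_of_one_le₀ he⟩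
        (powMean_rpow_le hb h ht ⟨hr1, min_le_right _ _⟩ p)).trans_eq ?_
      rw [rpow_rpow hb, mul_inv_cancel₀ (by positivity), CFC.rpow_one b hb.nonneg]
    have hcp : c ^ ((p - t) * r + t) = powMean r (a ^ t) (b ^ p) := by
      rw [hc, rpow_rpow hm, inv_mul_cancel₀ (by positivity), CFC.rpow_one _ hm.nonneg]
    have hsr1 : 1 ≤ s / r := (one_le_div hr0).2 (min_le_left _ _)
    have hsr2 : s / r ≤ 2 ^ n := by
      rw [div_le_iff₀ hr0, hr]
      rcases min_choice s 2 with h' | h' <;> rw [h']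
      · exact le_mul_of_one_le_left (by positivity) (one_le_pow₀ one_le_two)
      · rwa [← pow_succ]
    have := ih hc0 (hcb.trans h) he hsr1 hsr2
    rw [hcp, powMean_powMean (ha.rpow _ _) (hb.rpow _ _), mul_div_cancel₀ _ hr0.ne'] at this
    have e : ((p - t) * r + t - t) * (s / r) + t = (p - t) * s + t := by
      field_simp
      ring
    rw [e] at this
    exact this.trans hcb

theorem powMean_rpow_rpow_inv_le' {t p s : ℝ} (ht : t ∈ Set.Icc (0 : ℝ) 1) (hp : 1 ≤ p)
    (hs : 1 ≤ s) (hb : IsStrictlyPositive b) (h : b ≤ a) :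
    powMean s (a ^ t) (b ^ p) ^ ((p - t) * s + t)⁻¹ ≤ b := by
  obtain ⟨n, hn⟩ := pow_unbounded_of_one_lt s one_lt_two
  exact powMean_rpow_rpow_inv_le ht n hb h hp hs hn.le

end CStarAlgebra

/-! ### The operator inequality for spectral means -/

section CStarAlgebra

variable {𝒜 : Type*} [CStarAlgebra 𝒜] [PartialOrder 𝒜] [StarOrderedRing 𝒜] {a b : 𝒜}

theorem rpow_conj_rpow_le_one_iff (ha : IsStrictlyPositive a) (hb : IsStrictlyPositive b)
    (t l : ℝ) : b ^ t * a ^ l * b ^ t ≤ 1 ↔ b ^ (2 * t) ≤ (a ^ (-1 : ℝ)) ^ l := by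
  have h1 : b ^ t * a ^ l * b ^ t ≤ 1 ↔ a ^ l ≤ b ^ (-(2 * t)) := by
    constructor <;> intro h
    · have := rpow_conj_le b (-t) h
      simp only [mul_one, mul_assoc, rpow_mul_rpow_mul hb, rpow_mul_rpow hb] at this
      rw [neg_add_cancel, add_neg_cancel, CFC.rpow_zero b hb.nonneg, one_mul, mul_one] at this
      convert this using 2
      ring
    · have := rpow_conj_le b t h
      rw [rpow_mul_rpow hb, rpow_mul_rpow hb] at this
      convert this using 1
      rw [show t + -(2 * t) + t = 0 by ring, CFC.rpow_zero b hb.nonneg]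
  have inv_inv {c : 𝒜} (hc : IsStrictlyPositive c) (x : ℝ) : (c ^ x) ^ (-1 : ℝ) = c ^ (-x) := by
    rw [rpow_rpow hc, mul_neg_one]
  rw [h1, rpow_rpow ha, neg_one_mul]
  constructor <;> intro h
  · have := CStarAlgebra.rpow_neg_one_le_rpow_neg_one h (ha.rpow _ _)
    rwa [inv_inv ha, inv_inv hb, neg_neg] at this
  · have := CStarAlgebra.rpow_neg_one_le_rpow_neg_one h (hb.rpow _ _)
    rwa [inv_inv ha, inv_inv hb, neg_neg] at this

/-- The `(k, t)`-spectral geometric mean in a C⋆-algebra. -/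
noncomputable def spectralMean (k t : ℝ) (a b : 𝒜) : 𝒜 :=
  powMean k (a ^ (-1 : ℝ)) b ^ t * a ^ (1 + 2 * t - 4 * k * t) * powMean k (a ^ (-1 : ℝ)) b ^ t

theorem IsStrictlyPositive.spectralMean (ha : IsStrictlyPositive a) (hb : IsStrictlyPositive b)
    (k t : ℝ) : IsStrictlyPositive (spectralMean k t a b) :=
  ((ha.rpow _ (-1)).powMean hb k).rpow_conj (ha.rpow _ _) t

theorem spectralMean_exponent_bounds {k t : ℝ} (hk2 : k ≤ 1 / 2) (ht : 0 < t)
    (ht2 : t ≤ 1 / 2) : 0 < 1 - 2 * k * t ∧ 1 ≤ 1 + 2 * t - 4 * k * t := by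
  have hkt : k * t ≤ 1 / 2 * t := mul_le_mul_of_nonneg_right hk2 ht.le
  constructor <;> nlinarith

/-- Grand Furuta applied to `g^{2t} ≤ c^l` with parameters `1/l`, `1/(2t)`, `1/k`: the inner powers
undo `l` and `2t`, and `c ♮_{1/k} g = b`. The bounds `l ≥ 1`, `t ≤ 1/2`, `k ≤ 1` put the parameters
in range. -/
theorem rpow_le_of_spectralMean_le_one (ha : IsStrictlyPositive a) (hb : IsStrictlyPositive b)
    {k t : ℝ} (hk : 0 < k) (hk2 : k ≤ 1 / 2) (ht : 0 < t) (ht2 : t ≤ 1 / 2)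
    (h : spectralMean k t a b ≤ 1) :
    b ^ (2 * k * t * (1 + 2 * t - 4 * k * t) / (1 - 2 * k * t)) ≤
      (a ^ (-1 : ℝ)) ^ (1 + 2 * t - 4 * k * t) := by
  obtain ⟨h1, h2⟩ := spectralMean_exponent_bounds hk2 ht ht2
  set l := 1 + 2 * t - 4 * k * t with hl
  have hl0 : 0 < l := by linarith
  have hc := ha.rpow a (-1)
  set c := a ^ (-1 : ℝ)
  have hg := hc.powMean hb k
  have hgc := (rpow_conj_rpow_le_one_iff ha hg t l).1 h
  have key := powMean_rpow_rpow_inv_le' (t := l⁻¹) (p := (2 * t)⁻¹) (s := k⁻¹)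
    ⟨by positivity, inv_le_one_of_one_le₀ h2⟩ ((one_le_inv₀ (by positivity)).2 (by linarith))
    ((one_le_inv₀ hk).2 (by linarith)) (hg.rpow _ (2 * t)) hgc
  rw [rpow_rpow hc, rpow_rpow hg, mul_inv_cancel₀ hl0.ne', mul_inv_cancel₀ (by positivity),
    CFC.rpow_one c hc.nonneg, CFC.rpow_one _ hg.nonneg, powMean_powMean hc hb,
    mul_inv_cancel₀ hk.ne', powMean_one hc hb] at key
  refine Eq.trans_le ?_ (key.trans hgc)
  congr 1
  have e : ((2 * t)⁻¹ - l⁻¹) * k⁻¹ + l⁻¹ = (1 - 2 * k * t) / (2 * k * t * l) := by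
    field_simp
    rw [hl]
    ring
  rw [e, inv_div]

theorem spectralMean_rpow_le_one (ha : IsStrictlyPositive a) (hb : IsStrictlyPositive b)
    {k t r : ℝ} (hk : 0 < k) (hk2 : k ≤ 1 / 2) (ht : 0 < t) (ht2 : t ≤ 1 / 2) (hr : 0 < r)
    (hr2 : r ≤ 2 * k * t * (1 + 2 * t - 4 * k * t) / (1 - 2 * k * t))
    (h : spectralMean k t a b ≤ 1) : spectralMean k t (a ^ r) (b ^ r) ≤ 1 := by
  obtain ⟨h1, h2⟩ := spectralMean_exponent_bounds hk2 ht ht2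
  have hbc := rpow_le_of_spectralMean_le_one ha hb hk hk2 ht ht2 h
  rw [spectralMean, rpow_conj_rpow_le_one_iff (ha.rpow _ _)
    (((ha.rpow _ r).rpow _ _).powMean (hb.rpow _ r) k)]
  set l := 1 + 2 * t - 4 * k * t with hl
  have hl0 : 0 < l := by linarith
  set d := 2 * k * t * l / (1 - 2 * k * t) with hd
  have hd0 : 0 < d := by positivity
  have har : (a ^ r) ^ (-1 : ℝ) = (a ^ (-1 : ℝ)) ^ r := by
    rw [rpow_rpow ha, rpow_rpow ha, mul_comm]
  rw [har]
  have hc := ha.rpow a (-1)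
  set c := a ^ (-1 : ℝ)
  -- The bound `r ≤ d` is exactly what Löwner–Heinz needs here. Taking `c^r #_k ·` and then the
  -- power `2t ≤ 1` gives the exponent `2t (r(1-k) + klr/d) = rl`.
  have hbr : b ^ r ≤ c ^ (l * (r / d)) := by
    have := CFC.rpow_le_rpow (p := r / d) ⟨by positivity, (div_le_one hd0).2 hr2⟩ hbc
    rwa [rpow_rpow hb, rpow_rpow hc, mul_div_cancel₀ _ hd0.ne'] at this
  have h5 := powMean_le_powMean_right (s := k) ⟨hk.le, by linarith⟩ (c ^ r) hbr
  rw [powMean_rpow_rpow hc] at h5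
  have h6 := CFC.rpow_le_rpow (p := 2 * t) ⟨by positivity, by linarith⟩ h5
  rw [rpow_rpow hc] at h6
  rw [rpow_rpow hc]
  refine h6.trans_eq ?_
  congr 1
  have e : l * (r / d) = r * (1 - 2 * k * t) / (2 * k * t) := by
    rw [hd]
    field_simp
  rw [e, hl]
  field_simp
  ring

theorem smul_rpow (ha : IsStrictlyPositive a) {γ : ℝ} (hγ : 0 < γ) (x : ℝ) :
    (γ • a) ^ x = γ ^ x • a ^ x := by
  have hpos : ∀ y ∈ spectrum ℝ a, 0 < y := fun y hy ↦
    lt_of_le_of_ne (spectrum_nonneg_of_nonneg ha.nonneg hy) fun h ↦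
      spectrum.zero_notMem ℝ ha.isUnit (h ▸ hy)
  have hs : IsSelfAdjoint a := ha.nonneg.isSelfAdjoint
  have h1 : γ • a = cfc (fun y : ℝ ↦ γ * y) a := by
    rw [cfc_const_mul γ (fun y : ℝ ↦ y) a, cfc_id' ℝ a]
  have h2 : ContinuousOn (fun y : ℝ ↦ y ^ x) (spectrum ℝ a) :=
    ContinuousOn.rpow_const continuousOn_id fun y hy ↦ Or.inl (hpos y hy).ne'
  rw [h1, CFC.cfc_rpow fun y hy ↦ mul_pos hγ (hpos y hy), CFC.rpow_eq_cfc_real ha.nonneg,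
    ← cfc_const_mul _ _ _ h2]
  exact cfc_congr fun y hy ↦ Real.mul_rpow hγ.le (hpos y hy).le

theorem IsStrictlyPositive.smul_pos (ha : IsStrictlyPositive a) {γ : ℝ} (hγ : 0 < γ) :
    IsStrictlyPositive (γ • a) :=
  (IsStrictlyPositive.iff_of_unital).2
    ⟨smul_nonneg hγ.le ha.nonneg, ha.isUnit.smul (Units.mk0 γ hγ.ne')⟩

theorem powMean_smul_right (ha : IsStrictlyPositive a) (hb : IsStrictlyPositive b) {γ : ℝ}
    (hγ : 0 < γ) (s : ℝ) : powMean s a (γ • b) = γ ^ s • powMean s a b := by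
  simp only [powMean, mul_smul_comm, smul_mul_assoc, smul_rpow (ha.rpow_conj hb _) hγ]

theorem spectralMean_smul_right (ha : IsStrictlyPositive a) (hb : IsStrictlyPositive b) {γ : ℝ}
    (hγ : 0 < γ) (k t : ℝ) :
    spectralMean k t a (γ • b) = γ ^ (2 * k * t) • spectralMean k t a b := by
  simp only [spectralMean, powMean_smul_right (ha.rpow a (-1)) hb hγ,
    smul_rpow ((ha.rpow a (-1)).powMean hb k) (Real.rpow_pos_of_pos hγ k), mul_smul_comm,
    smul_mul_assoc, smul_smul]
  rw [← Real.rpow_mul hγ.le, ← Real.rpow_add hγ]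
  ring_nf

theorem smul_le_one_iff {γ : ℝ} (hγ : 0 < γ) : γ⁻¹ • a ≤ 1 ↔ a ≤ γ • (1 : 𝒜) := by
  constructor <;> intro h
  · simpa [smul_smul, hγ.ne'] using smul_le_smul_of_nonneg_left h hγ.le
  · simpa [smul_smul, hγ.ne'] using smul_le_smul_of_nonneg_left h (inv_pos.2 hγ).le

theorem spectralMean_rpow_le (ha : IsStrictlyPositive a) (hb : IsStrictlyPositive b)
    {k t r γ : ℝ} (hk : 0 < k) (hk2 : k ≤ 1 / 2) (ht : 0 < t) (ht2 : t ≤ 1 / 2) (hr : 0 < r)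
    (hr2 : r ≤ 2 * k * t * (1 + 2 * t - 4 * k * t) / (1 - 2 * k * t)) (hγ : 0 < γ)
    (h : spectralMean k t a b ≤ γ • (1 : 𝒜)) :
    spectralMean k t (a ^ r) (b ^ r) ≤ γ ^ r • (1 : 𝒜) := by
  have hkt : 0 < 2 * k * t := by positivity
  -- The spectral mean is homogeneous of degree `2kt` in `b`, so replacing `b` by `α • b` scales it
  -- by `γ⁻¹`.
  set α := (γ⁻¹) ^ (2 * k * t)⁻¹ with hα
  have hα0 : 0 < α := Real.rpow_pos_of_pos (inv_pos.2 hγ) _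
  have hαγ : α ^ (2 * k * t) = γ⁻¹ := Real.rpow_inv_rpow (inv_pos.2 hγ).le hkt.ne'
  have h1 : spectralMean k t a (α • b) ≤ 1 := by
    rwa [spectralMean_smul_right ha hb hα0, hαγ, smul_le_one_iff hγ]
  have h2 := spectralMean_rpow_le_one ha (hb.smul_pos hα0) hk hk2 ht ht2 hr hr2 h1
  rw [smul_rpow hb hα0, spectralMean_smul_right (ha.rpow _ _) (hb.rpow _ _)
    (Real.rpow_pos_of_pos hα0 r), ← Real.rpow_mul hα0.le, mul_comm r, Real.rpow_mul hα0.le, hαγ,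
    Real.inv_rpow hγ.le, smul_le_one_iff (Real.rpow_pos_of_pos hγ r)] at h2
  exact h2

theorem rpow_le_smul_one (ha : IsStrictlyPositive a) {γ x : ℝ} (hx : 0 < x)
    (h : a ≤ γ • (1 : 𝒜)) : a ^ x ≤ γ ^ x • (1 : 𝒜) := by
  rw [← Algebra.algebraMap_eq_smul_one] at h ⊢
  rw [CFC.rpow_eq_cfc_real ha.nonneg]
  have hs : IsSelfAdjoint a := ha.nonneg.isSelfAdjoint
  rw [le_algebraMap_iff_spectrum_le] at h
  refine cfc_le_algebraMap _ _ _ (fun y hy ↦ ?_) (by fun_prop (disch := positivity))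
  exact Real.rpow_le_rpow (spectrum_nonneg_of_nonneg ha.nonneg hy) (h y hy) hx.le

/-- The mean `g = a⁻¹ # b` solves the Riccati equation `b = g a g`, and `b⁻¹ # a = g⁻¹`; both sides
are therefore `g^{t-1} b g^{t-1}`. -/
theorem spectralMean_half_swap (ha : IsStrictlyPositive a) (hb : IsStrictlyPositive b) (t : ℝ) :
    powMean (1 / 2) (a ^ (-1 : ℝ)) b ^ t * a * powMean (1 / 2) (a ^ (-1 : ℝ)) b ^ t =
      powMean (1 / 2) (b ^ (-1 : ℝ)) a ^ (1 - t) * b *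
        powMean (1 / 2) (b ^ (-1 : ℝ)) a ^ (1 - t) := by
  have hc := ha.rpow a (-1)
  have hg := hc.powMean hb (1 / 2)
  have h1 : b = powMean (1 / 2) (a ^ (-1 : ℝ)) b * a * powMean (1 / 2) (a ^ (-1 : ℝ)) b := by
    have h := powMean_powMean hc hb (1 / 2) 2
    rw [div_mul_cancel₀ _ two_ne_zero, powMean_one hc hb, powMean_eq_flip hc hg, rpow_rpow ha,
      show (2 : ℝ) - 1 = 1 by norm_num, show (-1 : ℝ) * -1 = 1 by norm_num,
      CFC.rpow_one a ha.nonneg, CFC.rpow_one _ (hg.rpow_conj ha _).nonneg] at h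
    conv_lhs => rw [← h]
    simp only [mul_assoc, rpow_mul_rpow_mul hg, rpow_mul_rpow hg]
    rw [add_halves, CFC.rpow_one _ hg.nonneg]
  set g := powMean (1 / 2) (a ^ (-1 : ℝ)) b with hgdef
  have h2 : a = g ^ (-1 : ℝ) * b * g ^ (-1 : ℝ) := by
    conv_rhs => rw [h1]
    conv_rhs => rw [← CFC.rpow_one g hg.nonneg]
    rw [rpow_rpow hg]
    simp only [mul_assoc, rpow_mul_rpow_mul hg, rpow_mul_rpow hg]
    norm_num
    simp [CFC.rpow_zero g hg.nonneg]
  have h3 : powMean (1 / 2) (b ^ (-1 : ℝ)) a = g ^ (-1 : ℝ) := by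
    have hm : IsStrictlyPositive (b ^ (1 / 2 : ℝ) * g ^ (-1 : ℝ) * b ^ (1 / 2 : ℝ)) :=
      hb.rpow_conj (hg.rpow _ _) _
    have e : (b ^ (-1 : ℝ)) ^ (-(1 / 2) : ℝ) * a * (b ^ (-1 : ℝ)) ^ (-(1 / 2) : ℝ) =
        (b ^ (1 / 2 : ℝ) * g ^ (-1 : ℝ) * b ^ (1 / 2 : ℝ)) ^ (2 : ℝ) := by
      have h := rpow_mul_rpow hm 1 1
      rw [one_add_one_eq_two, CFC.rpow_one _ hm.nonneg] at h
      rw [← h]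
      conv_lhs => rw [h2]
      simp only [rpow_rpow hb, mul_assoc, rpow_mul_rpow_mul hb]
      norm_num [CFC.rpow_one b hb.nonneg]
    rw [powMean, e, rpow_rpow hm, mul_one_div_cancel two_ne_zero, CFC.rpow_one _ hm.nonneg]
    simp only [rpow_rpow hb, mul_assoc, rpow_mul_rpow_mul hb, rpow_mul_rpow hb]
    norm_num
    simp [CFC.rpow_zero b hb.nonneg]
  rw [h3, rpow_rpow hg]
  conv_lhs => rw [h2]
  simp only [mul_assoc, rpow_mul_rpow_mul hg, rpow_mul_rpow hg]
  ring_nf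

end CStarAlgebra

/-! ### Compound matrices -/

section Compound

open Matrix Set.powersetCard

theorem diagonal_rpow {κ : Type*} [Fintype κ] [DecidableEq κ] {d : κ → ℝ} (hd : ∀ i, 0 ≤ d i)
    (r : ℝ) : (diagonal fun i ↦ (d i : ℂ)) ^ r = diagonal fun i ↦ ((d i ^ r : ℝ) : ℂ) := by
  set D : Matrix κ κ ℂ := diagonal fun i ↦ (d i : ℂ) with hD
  have hD0 : 0 ≤ D := by
    rw [nonneg_iff_posSemidef, posSemidef_diagonal_iff]
    exact fun i ↦ by simpa using hd i
  -- Interpolating at the spectrum and at all `d i` replaces the power by a polynomial, which acts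
  -- entrywise on a diagonal matrix, without computing the spectrum.
  set S : Finset ℝ := (D.finite_real_spectrum.union (Set.finite_range d)).toFinset
  let P := Lagrange.interpolate S id (fun x : ℝ ↦ x ^ r)
  have hP (x : ℝ) (hx : x ∈ S) : P.eval x = x ^ r :=
    Lagrange.eval_interpolate_at_node (v := id) _ Function.injective_id.injOn hx
  rw [CFC.rpow_eq_cfc_real hD0]
  have h1 : cfc (fun x : ℝ ↦ x ^ r) D = cfc P.eval D :=
    cfc_congr fun x hx ↦ (hP x (by simp [S, hx])).symm
  have h2 : D = diagonalAlgHom ℝ (fun i ↦ (d i : ℂ)) := rfl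
  rw [h1, cfc_polynomial P D hD0.isSelfAdjoint, h2, Polynomial.aeval_algHom_apply]
  change diagonal _ = _
  congr 1
  ext1 i
  have h3 : (Polynomial.aeval (fun i ↦ (d i : ℂ)) P) i = Polynomial.aeval (d i : ℂ) P :=
    (Polynomial.aeval_algHom_apply (Pi.evalAlgHom ℝ (fun _ : κ ↦ ℂ) i) _ P).symm
  rw [h3, ← hP (d i) (by simp [S])]
  exact Polynomial.aeval_algebraMap_apply ℂ (d i) P

variable {n : ℕ}

/-- The `j`-th compound matrix: the matrix of all `j × j` minors. -/
noncomputable def compound (j : ℕ) (A : Matrix (Fin n) (Fin n) ℂ) :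
    Matrix (Set.powersetCard (Fin n) j) (Set.powersetCard (Fin n) j) ℂ :=
  Matrix.of fun s t ↦ (A.submatrix (ofFinEmbEquiv.symm s) (ofFinEmbEquiv.symm t)).det

/-- With this identification, Cauchy–Binet (`compound_mul`) is functoriality of the exterior power.
-/
theorem compound_eq_toMatrix (j : ℕ) (A : Matrix (Fin n) (Fin n) ℂ) :
    compound j A = LinearMap.toMatrix ((Pi.basisFun ℂ (Fin n)).exteriorPower j)
      ((Pi.basisFun ℂ (Fin n)).exteriorPower j) (exteriorPower.map j (toLin' A)) := by
  ext s t
  rw [LinearMap.toMatrix_apply, exteriorPower.basis_apply, exteriorPower.map_apply_ιMulti_family,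
    exteriorPower.basis_repr_apply, exteriorPower.ιMulti_family,
    exteriorPower.ιMultiDual_apply_ιMulti, ← det_transpose]
  simp only [compound, of_apply]
  congr 1
  ext i k
  simp

theorem compound_mul (j : ℕ) (A B : Matrix (Fin n) (Fin n) ℂ) :
    compound j (A * B) = compound j A * compound j B := by
  simp only [compound_eq_toMatrix]
  rw [toLin'_mul, exteriorPower.map_comp,
    LinearMap.toMatrix_comp _ ((Pi.basisFun ℂ (Fin n)).exteriorPower j) _]

theorem compound_conjTranspose (j : ℕ) (A : Matrix (Fin n) (Fin n) ℂ) :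
    compound j Aᴴ = (compound j A)ᴴ := by
  ext s t
  simp only [compound, conjTranspose_apply, of_apply, ← det_conjTranspose]
  rfl

theorem compound_diagonal (j : ℕ) (d : Fin n → ℂ) :
    compound j (diagonal d) = diagonal fun s ↦ ∏ i : Fin j, d (ofFinEmbEquiv.symm s i) := by
  ext s t
  rcases eq_or_ne s t with rfl | hst
  · rw [diagonal_apply_eq]
    simp only [compound, of_apply]
    rw [submatrix_diagonal _ _ (ofFinEmbEquiv.symm s).injective, det_diagonal]
    rfl
  · rw [diagonal_apply_ne _ hst]
    obtain ⟨i, his, hit⟩ := (exists_mem_notMem_iff_ne s t).mp hst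
    obtain ⟨k, rfl⟩ := (mem_range_ofFinEmbEquiv_symm_iff_mem s i).mpr his
    refine det_eq_zero_of_row_eq_zero k fun l ↦ diagonal_apply_ne _ fun h ↦ hit ?_
    rw [h]
    exact (mem_range_ofFinEmbEquiv_symm_iff_mem t _).mp ⟨l, rfl⟩

theorem compound_one (j : ℕ) : compound j (1 : Matrix (Fin n) (Fin n) ℂ) = 1 := by
  rw [← diagonal_one, compound_diagonal]
  simp

theorem compound_mem_unitaryGroup (j : ℕ) (U : unitaryGroup (Fin n) ℂ) :
    compound j (U : Matrix (Fin n) (Fin n) ℂ) ∈ unitary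
      (Matrix (Set.powersetCard (Fin n) j) (Set.powersetCard (Fin n) j) ℂ) := by
  rw [Unitary.mem_iff, star_eq_conjTranspose, ← compound_conjTranspose, ← compound_mul,
    ← compound_mul, ← star_eq_conjTranspose, U.2.1, U.2.2, compound_one]
  exact ⟨rfl, rfl⟩

variable {A : Matrix (Fin n) (Fin n) ℂ}

theorem compound_eq_conj (j : ℕ) (hA : A.IsHermitian) :
    compound j A = compound j (hA.eigenvectorUnitary : Matrix (Fin n) (Fin n) ℂ) *
      diagonal (fun s ↦ ((∏ i : Fin j, hA.eigenvalues (ofFinEmbEquiv.symm s i) : ℝ) : ℂ)) *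
      star (compound j (hA.eigenvectorUnitary : Matrix (Fin n) (Fin n) ℂ)) := by
  conv_lhs => rw [hA.spectral_theorem, Unitary.conjStarAlgAut_apply, compound_mul, compound_mul,
    compound_diagonal, star_eq_conjTranspose, compound_conjTranspose]
  rw [star_eq_conjTranspose]
  congr 3
  ext s
  simp

theorem rpow_eq_conj (hA : A.PosDef) (r : ℝ) :
    A ^ r = (hA.1.eigenvectorUnitary : Matrix (Fin n) (Fin n) ℂ) *
      diagonal (fun i ↦ ((hA.1.eigenvalues i ^ r : ℝ) : ℂ)) *
      star (hA.1.eigenvectorUnitary : Matrix (Fin n) (Fin n) ℂ) := by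
  rw [CFC.rpow_eq_cfc_real hA.posSemidef.nonneg, hA.1.cfc_eq, IsHermitian.cfc,
    Unitary.conjStarAlgAut_apply]
  rfl

theorem Matrix.PosDef.rpow (hA : A.PosDef) (r : ℝ) : (A ^ r).PosDef :=
  (hA.isStrictlyPositive.rpow A r).posDef

theorem compound_isStrictlyPositive (j : ℕ) (hA : A.PosDef) :
    IsStrictlyPositive (compound j A) := by
  obtain ⟨c, hc, rfl⟩ := CStarAlgebra.isStrictlyPositive_iff_eq_star_mul_self.1
    hA.isStrictlyPositive
  rw [star_eq_conjTranspose, compound_mul, compound_conjTranspose,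
    CStarAlgebra.isStrictlyPositive_iff_eq_star_mul_self]
  refine ⟨compound j c, ?_, rfl⟩
  obtain ⟨c, rfl⟩ := hc
  refine ⟨⟨compound j c, compound j (c⁻¹ : (Matrix (Fin n) (Fin n) ℂ)ˣ), ?_, ?_⟩, rfl⟩ <;>
  simp [← compound_mul, compound_one, -coe_units_inv]

/-- In an eigenbasis of `A`, the compound is diagonal up to a unitary, with products of eigenvalues
as entries, and the power of a product is the product of the powers. -/
theorem compound_rpow (j : ℕ) (hA : A.PosDef) (r : ℝ) :
    compound j (A ^ r) = compound j A ^ r := by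
  have hpos (s : Set.powersetCard (Fin n) j) :
      0 < ∏ i : Fin j, hA.1.eigenvalues (ofFinEmbEquiv.symm s i) :=
    Finset.prod_pos fun i _ ↦ hA.eigenvalues_pos _
  have hD : IsStrictlyPositive (diagonal
      (fun s : Set.powersetCard (Fin n) j ↦
        ((∏ i : Fin j, hA.1.eigenvalues (ofFinEmbEquiv.symm s i) : ℝ) : ℂ))) := by
    rw [isStrictlyPositive_iff_posDef, posDef_diagonal_iff]
    exact fun s ↦ Complex.zero_lt_real.2 (hpos s)
  have h := unitary_conj_rpow ⟨_, compound_mem_unitaryGroup j hA.1.eigenvectorUnitary⟩ hD r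
  rw [compound_eq_conj j hA.1]
  refine Eq.trans ?_ h.symm
  rw [diagonal_rpow fun s ↦ (hpos s).le, rpow_eq_conj hA, compound_mul, compound_mul,
    star_eq_conjTranspose, compound_conjTranspose, compound_diagonal]
  congr 3
  ext s
  rw [← Real.finsetProd_rpow _ _ fun i _ ↦ (hA.eigenvalues_pos _).le]
  simp

theorem compound_le_smul_one_iff_prod_le (j : ℕ) (hA : A.IsHermitian) (γ : ℝ) :
    compound j A ≤ γ • 1 ↔ ∀ s : Set.powersetCard (Fin n) j,
      ∏ i : Fin j, hA.eigenvalues (ofFinEmbEquiv.symm s i) ≤ γ := by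
  have hV := compound_mem_unitaryGroup j hA.eigenvectorUnitary
  rw [compound_eq_conj j hA]
  set V := compound j (hA.eigenvectorUnitary : Matrix (Fin n) (Fin n) ℂ)
  have h1 : (γ • (1 : Matrix (Set.powersetCard (Fin n) j) (Set.powersetCard (Fin n) j) ℂ)) =
      V * diagonal (fun _ ↦ (γ : ℂ)) * star V := by
    have : (diagonal fun _ ↦ (γ : ℂ)) =
        (γ • (1 : Matrix (Set.powersetCard (Fin n) j) (Set.powersetCard (Fin n) j) ℂ)) := by
      ext s t
      simp [diagonal_apply, one_apply, Algebra.smul_def]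
    rw [this, mul_smul_comm, mul_one, smul_mul_assoc, hV.2]
  have hU : IsUnit V := ⟨⟨V, star V, hV.2, hV.1⟩, rfl⟩
  rw [h1, le_iff, ← sub_mul, ← mul_sub, hU.posSemidef_star_right_conjugate_iff, diagonal_sub,
    posSemidef_diagonal_iff]
  simp only [← Complex.ofReal_sub, Complex.zero_le_real, sub_nonneg]

end Compound

/-! ### From compounds to log-majorization -/

section LogMajorization

open Matrix Set.powersetCard

/-- Counting from zero, the `i`-th smallest element of `s` is at least `i`, so moving it down to `i`
can only increase its factor. -/
theorem prod_le_prod_filter_lt {m : ℕ} {f : Fin m → ℝ} (hf : Antitone f) (hf0 : ∀ i, 0 ≤ f i)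
    (s : Finset (Fin m)) : ∏ i ∈ s, f i ≤ ∏ i : Fin m with i.val < s.card, f i := by
  have hs : s.card ≤ m := by simpa using s.card_le_univ
  have h1 : ∏ i ∈ s, f i = ∏ i : Fin s.card, f (s.orderEmbOfFin rfl i) := by
    conv_lhs => rw [← Finset.map_orderEmbOfFin_univ s rfl, Finset.prod_map]
    rfl
  have h2 : ∏ i : Fin m with i.val < s.card, f i = ∏ i : Fin s.card, f (Fin.castLE hs i) := by
    refine Finset.prod_bij' (fun i hi ↦ ⟨i.val, (Finset.mem_filter.1 hi).2⟩)
      (fun i _ ↦ Fin.castLE hs i) ?_ ?_ ?_ ?_ ?_ <;> simp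
  rw [h1, h2]
  refine Finset.prod_le_prod (fun i _ ↦ hf0 _) fun i hi ↦ hf ?_
  clear hi
  have hmono : StrictMono fun i ↦ (s.orderEmbOfFin rfl i : Fin m) :=
    (s.orderEmbOfFin rfl).strictMono
  rw [Fin.le_def, Fin.val_castLE]
  obtain ⟨i, hi⟩ := i
  induction i with
  | zero => exact Nat.zero_le _
  | succ i ih =>
    have := ih (Nat.lt_of_succ_lt hi)
    have h3 : s.orderEmbOfFin rfl ⟨i, Nat.lt_of_succ_lt hi⟩ < s.orderEmbOfFin rfl ⟨i + 1, hi⟩ :=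
      hmono (Fin.mk_lt_mk.2 i.lt_succ_self)
    exact Nat.succ_le_of_lt (this.trans_lt h3)

variable {n : ℕ} {A B : Matrix (Fin n) (Fin n) ℂ}

/-- The eigenvalues of the compound are the products over `j`-subsets, and the `j` largest
eigenvalues give the largest product. The bound `j ≤ n` ensures that such a subset exists. -/
theorem compound_le_smul_one_iff {j : ℕ} (hj : j ≤ n) (hA : A.PosSemidef) (γ : ℝ) :
    compound j A ≤ γ • 1 ↔ eigenvalueProd hA.isHermitian j ≤ γ := by
  rw [compound_le_smul_one_iff_prod_le j hA.isHermitian]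
  let e : Fin (Fintype.card (Fin n)) ≃ Fin n := Fintype.equivOfCardEq (Fintype.card_fin _)
  have hprod (s : Set.powersetCard (Fin n) j) :
      ∏ i : Fin j, hA.isHermitian.eigenvalues (ofFinEmbEquiv.symm s i) =
        ∏ i ∈ s.val.map e.symm.toEmbedding, hA.isHermitian.eigenvalues₀ i := by
    rw [Finset.prod_map]
    conv_rhs => rw [← Finset.map_orderEmbOfFin_univ s.val s.prop, Finset.prod_map]
    rfl
  have h0 (i) : 0 ≤ hA.isHermitian.eigenvalues₀ i := by
    simpa [IsHermitian.eigenvalues, e] using hA.eigenvalues_nonneg (e i)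
  constructor
  · intro h
    let T : Finset (Fin (Fintype.card (Fin n))) := Finset.univ.filter fun i ↦ i.val < j
    have hT : (T.map e.toEmbedding).card = j := by
      rw [Finset.card_map, Fin.card_filter_val_lt, Fintype.card_fin, min_eq_right hj]
    have := h ⟨T.map e.toEmbedding, hT⟩
    rw [hprod] at this
    simpa [Finset.map_map, T, eigenvalueProd] using this
  · intro h s
    rw [hprod]
    have := prod_le_prod_filter_lt hA.isHermitian.eigenvalues₀_antitone h0
      (s.val.map e.symm.toEmbedding)
    rw [Finset.card_map, s.prop] at this
    exact this.trans h

theorem eigenvalueProd_pos (hA : A.PosDef) (j : ℕ) : 0 < eigenvalueProd hA.isHermitian j := by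
  refine Finset.prod_pos fun i _ ↦ ?_
  simpa [IsHermitian.eigenvalues] using
    hA.eigenvalues_pos (Fintype.equivOfCardEq (Fintype.card_fin _) i)

theorem eigenvalueProd_card (hA : A.PosSemidef) :
    eigenvalueProd hA.isHermitian (Fintype.card (Fin n)) = ‖A.det‖ := by
  have h : eigenvalueProd hA.isHermitian (Fintype.card (Fin n)) =
      ∏ i, hA.isHermitian.eigenvalues i := by
    rw [eigenvalueProd, Finset.filter_true_of_mem fun i _ ↦ i.isLt]
    exact (Equiv.prod_comp (Fintype.equivOfCardEq (Fintype.card_fin _)).symm _).symm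
  rw [h, hA.isHermitian.det_eq_prod_eigenvalues, norm_prod]
  exact Finset.prod_congr rfl fun i _ ↦ by simp [abs_of_nonneg (hA.eigenvalues_nonneg i)]

theorem norm_det_rpow (hA : A.PosDef) (r : ℝ) : ‖(A ^ r).det‖ = ‖A.det‖ ^ r := by
  have h : (A ^ r).det = ∏ i, ((hA.1.eigenvalues i ^ r : ℝ) : ℂ) := by
    rw [rpow_eq_conj hA, det_mul_right_comm, Unitary.mul_star_self_of_mem
      hA.1.eigenvectorUnitary.2, one_mul, det_diagonal]
  rw [h, hA.1.det_eq_prod_eigenvalues, norm_prod, norm_prod,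
    ← Real.finsetProd_rpow _ _ fun i _ ↦ norm_nonneg _]
  refine Finset.prod_congr rfl fun i _ ↦ ?_
  have := hA.eigenvalues_pos i
  rw [Complex.norm_real, Real.norm_of_nonneg (by positivity)]
  simp [abs_of_pos this]

theorem norm_det_powMean (hA : A.PosDef) (hB : B.PosDef) (s : ℝ) :
    ‖(powMean s A B).det‖ = ‖A.det‖ ^ (1 - s) * ‖B.det‖ ^ s := by
  have hA0 : 0 < ‖A.det‖ := norm_pos_iff.2 hA.det_pos.ne'
  have hM := (hA.isStrictlyPositive.rpow_conj hB.isStrictlyPositive (-(1 / 2))).posDef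
  rw [powMean, det_mul, det_mul, norm_mul, norm_mul, norm_det_rpow hM, det_mul, det_mul, norm_mul,
    norm_mul, norm_det_rpow hA, norm_det_rpow hA, Real.mul_rpow (by positivity) (by positivity),
    Real.mul_rpow (by positivity) (by positivity), ← Real.rpow_mul hA0.le]
  rw [show ∀ x y z : ℝ, x * (y * z * y) * x = (x * y * y * x) * z by intros; ring,
    ← Real.rpow_add hA0, ← Real.rpow_add hA0, ← Real.rpow_add hA0]
  ring_nf

theorem Matrix.PosDef.powMean (hA : A.PosDef) (hB : B.PosDef) (s : ℝ) : (powMean s A B).PosDef :=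
  (hA.isStrictlyPositive.powMean hB.isStrictlyPositive s).posDef

theorem Matrix.PosDef.spectralMean (hA : A.PosDef) (hB : B.PosDef) (k t : ℝ) :
    (spectralMean k t A B).PosDef :=
  (hA.isStrictlyPositive.spectralMean hB.isStrictlyPositive k t).posDef

theorem norm_det_spectralMean (hA : A.PosDef) (hB : B.PosDef) (k t : ℝ) :
    ‖(spectralMean k t A B).det‖ = ‖A.det‖ ^ (1 - 2 * k * t) * ‖B.det‖ ^ (2 * k * t) := by
  have hA0 : 0 < ‖A.det‖ := norm_pos_iff.2 hA.det_pos.ne'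
  have hB0 : 0 < ‖B.det‖ := norm_pos_iff.2 hB.det_pos.ne'
  rw [spectralMean, det_mul, det_mul, norm_mul, norm_mul,
    norm_det_rpow ((hA.rpow _).powMean hB k), norm_det_powMean (hA.rpow _) hB, norm_det_rpow hA,
    norm_det_rpow hA, Real.mul_rpow (by positivity) (by positivity), ← Real.rpow_mul hA0.le,
    ← Real.rpow_mul hA0.le, ← Real.rpow_mul hB0.le]
  rw [show ∀ x y z : ℝ, x * y * z * (x * y) = (x * z * x) * (y * y) by intros; ring,
    ← Real.rpow_add hA0, ← Real.rpow_add hA0, ← Real.rpow_add hB0]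
  ring_nf

theorem norm_det_spectralMean_rpow (hA : A.PosDef) (hB : B.PosDef) (k t : ℝ) {p : ℝ}
    (hp : p ≠ 0) : ‖(spectralMean k t (A ^ p) (B ^ p) ^ (1 / p)).det‖ =
      ‖A.det‖ ^ (1 - 2 * k * t) * ‖B.det‖ ^ (2 * k * t) := by
  have h0 (C : Matrix (Fin n) (Fin n) ℂ) : 0 ≤ ‖C.det‖ := norm_nonneg _
  rw [norm_det_rpow ((hA.rpow p).spectralMean (hB.rpow p) k t),
    norm_det_spectralMean (hA.rpow p) (hB.rpow p), norm_det_rpow hA, norm_det_rpow hB,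
    Real.mul_rpow (Real.rpow_nonneg (Real.rpow_nonneg (h0 _) _) _)
      (Real.rpow_nonneg (Real.rpow_nonneg (h0 _) _) _), ← Real.rpow_mul (h0 _),
    ← Real.rpow_mul (h0 _), ← Real.rpow_mul (h0 _), ← Real.rpow_mul (h0 _)]
  congr 2 <;> field_simp

theorem compound_powMean (j : ℕ) (hA : A.PosDef) (hB : B.PosDef) (s : ℝ) :
    compound j (powMean s A B) = powMean s (compound j A) (compound j B) := by
  have hM := (hA.isStrictlyPositive.rpow_conj hB.isStrictlyPositive (-(1 / 2))).posDef
  simp only [powMean, compound_mul, compound_rpow j hA, compound_rpow j hM]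

theorem compound_spectralMean (j : ℕ) (hA : A.PosDef) (hB : B.PosDef) (k t : ℝ) :
    compound j (spectralMean k t A B) = spectralMean k t (compound j A) (compound j B) := by
  simp only [spectralMean, compound_mul, compound_rpow j hA,
    compound_rpow j ((hA.rpow _).powMean hB k), compound_powMean j (hA.rpow (-1)) hB]

theorem logMajorizedBy_spectralMean (hA : A.PosDef) (hB : B.PosDef) {k t p q : ℝ} (hk : 0 < k)
    (hk2 : k ≤ 1 / 2) (ht : 0 < t) (ht2 : t ≤ 1 / 2) (hq : 0 < q)
    (hqp : q ≤ 2 * k * t * (1 + 2 * t - 4 * k * t) / (1 - 2 * k * t) * p) :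
    LogMajorizedBy (spectralMean k t (A ^ q) (B ^ q) ^ (1 / q))
      (spectralMean k t (A ^ p) (B ^ p) ^ (1 / p)) := by
  obtain ⟨h1, h2⟩ := spectralMean_exponent_bounds hk2 ht ht2
  have hc : 0 < 2 * k * t * (1 + 2 * t - 4 * k * t) / (1 - 2 * k * t) :=
    div_pos (mul_pos (by positivity) (by linarith)) h1
  have hp : 0 < p := pos_of_mul_pos_right (hq.trans_le hqp) hc.le
  have hF (r : ℝ) := (hA.rpow r).spectralMean (hB.rpow r) k t
  have hX := (hF q).rpow (1 / q)
  have hY := (hF p).rpow (1 / p)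
  refine ⟨hX.posSemidef, hY.posSemidef, fun j _ hj ↦ ?_, ?_⟩
  · rw [Fintype.card_fin] at hj
    rw [← compound_le_smul_one_iff hj hX.posSemidef]
    have hγ := eigenvalueProd_pos hY j
    have hle := (compound_le_smul_one_iff hj hY.posSemidef _).2 le_rfl
    set γ := eigenvalueProd hY.posSemidef.isHermitian j
    have hAj := compound_isStrictlyPositive j hA
    have hBj := compound_isStrictlyPositive j hB
    have e (r : ℝ) : compound j (spectralMean k t (A ^ r) (B ^ r)) =
        spectralMean k t (compound j A ^ r) (compound j B ^ r) := by
      rw [compound_spectralMean j (hA.rpow r) (hB.rpow r), compound_rpow j hA, compound_rpow j hB]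
    have hS (r : ℝ) := (hAj.rpow _ r).spectralMean (hBj.rpow _ r) k t
    rw [compound_rpow j (hF _), e] at hle ⊢
    have h5 := rpow_le_smul_one ((hS p).rpow _ _) hp hle
    rw [rpow_rpow (hS p), one_div_mul_cancel hp.ne', CFC.rpow_one _ (hS p).nonneg] at h5
    -- Apply the inequality to the `p`-th powers of the compounds with `r = q / p`, which turns them
    -- into `q`-th powers.
    have h6 := spectralMean_rpow_le (hAj.rpow _ p) (hBj.rpow _ p) hk hk2 ht ht2
      (div_pos hq hp) ((div_le_iff₀ hp).2 hqp) (Real.rpow_pos_of_pos hγ p) h5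
    rw [rpow_rpow hAj, rpow_rpow hBj, ← Real.rpow_mul hγ.le, mul_div_cancel₀ _ hp.ne'] at h6
    have h7 := rpow_le_smul_one (hS q) (one_div_pos.2 hq) h6
    rwa [← Real.rpow_mul hγ.le, mul_one_div_cancel hq.ne', Real.rpow_one] at h7
  · rw [eigenvalueProd_card hX.posSemidef, eigenvalueProd_card hY.posSemidef,
      norm_det_spectralMean_rpow hA hB k t hq.ne', norm_det_spectralMean_rpow hA hB k t hp.ne']

theorem inv_eq_rpow_neg_one (hA : A.PosDef) : A⁻¹ = A ^ (-1 : ℝ) := by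
  rw [nonsing_inv_eq_ringInverse]
  exact CFC.inverse_eq_rpow_neg_one hA.isStrictlyPositive

theorem spectralGeomMeanKT_eq (hA : A.PosDef) (k t : ℝ) :
    spectralGeomMeanKT k t A B = spectralMean k t A B := by
  rw [spectralGeomMeanKT, inv_eq_rpow_neg_one hA]
  rfl

theorem spectralGeomMeanTilde_eq (hA : A.PosDef) (k : ℝ) :
    spectralGeomMeanTilde k A B = spectralMean k (1 / 2) A B := by
  rw [← spectralGeomMeanKT_eq hA, spectralGeomMeanKT, spectralGeomMeanTilde]
  ring_nf

theorem spectralGeomMean_eq (hA : A.PosDef) (t : ℝ) :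
    spectralGeomMean t A B = spectralMean (1 / 2) t A B := by
  rw [← spectralGeomMeanKT_eq hA, spectralGeomMeanKT, spectralGeomMean,
    show 1 + 2 * t - 4 * (1 / 2) * t = 1 by ring,
    CFC.rpow_one A hA.posSemidef.nonneg]

theorem spectralGeomMean_swap (hA : A.PosDef) (hB : B.PosDef) (t : ℝ) :
    spectralGeomMean t A B = spectralGeomMean (1 - t) B A := by
  rw [spectralGeomMean, spectralGeomMean, inv_eq_rpow_neg_one hA, inv_eq_rpow_neg_one hB]
  exact spectralMean_half_swap hA.isStrictlyPositive hB.isStrictlyPositive t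

theorem logMajorizedBy_spectralGeomMean (hA : A.PosDef) (hB : B.PosDef) {t p q : ℝ} (ht : 0 < t)
    (ht2 : t ≤ 1 / 2) (hq : 0 < q) (hqp : q ≤ t / (1 - t) * p) :
    LogMajorizedBy (spectralGeomMean t (A ^ q) (B ^ q) ^ (1 / q))
      (spectralGeomMean t (A ^ p) (B ^ p) ^ (1 / p)) := by
  rw [spectralGeomMean_eq (hA.rpow q), spectralGeomMean_eq (hA.rpow p)]
  refine logMajorizedBy_spectralMean hA hB (by norm_num) le_rfl ht ht2 hq (hqp.trans_eq ?_)
  -- At `k = 1/2` one has `l = 1`, so the constant is `t / (1 - t)`.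
  ring_nf

end LogMajorization

theorem mainTheorem4 (n : ℕ) (A B : Matrix (Fin n) (Fin n) ℂ) (hA : A.PosDef) (hB : B.PosDef) :
    (∀ k t L p q : ℝ, 0 < k → k ≤ 1 / 2 → 0 < t → t ≤ 1 / 2 → L = 1 + 2 * t - 4 * k * t →
      0 < q → q ≤ 2 * k * t * L / (1 - 2 * k * t) * p →
      LogMajorizedBy (spectralGeomMeanKT k t (A ^ q) (B ^ q) ^ (1 / q))
        (spectralGeomMeanKT k t (A ^ p) (B ^ p) ^ (1 / p))) ∧
    (∀ t p q : ℝ, 0 < t → t < 1 → 0 < q → q ≤ min (t / (1 - t)) ((1 - t) / t) * p →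
      LogMajorizedBy (spectralGeomMean t (A ^ q) (B ^ q) ^ (1 / q))
        (spectralGeomMean t (A ^ p) (B ^ p) ^ (1 / p))) ∧
    (∀ k p q : ℝ, 0 < k → k ≤ 1 / 2 → 0 < q → q ≤ 2 * k * p →
      LogMajorizedBy (spectralGeomMeanTilde k (A ^ q) (B ^ q) ^ (1 / q))
        (spectralGeomMeanTilde k (A ^ p) (B ^ p) ^ (1 / p))) := by
  refine ⟨?_, ?_, ?_⟩
  · rintro k t L p q hk hk2 ht ht2 rfl hq hqp
    rw [spectralGeomMeanKT_eq (hA.rpow q), spectralGeomMeanKT_eq (hA.rpow p)]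
    exact logMajorizedBy_spectralMean hA hB hk hk2 ht ht2 hq hqp
  · intro t p q ht ht1 hq hqp
    have h1t : 0 < 1 - t := sub_pos.2 ht1
    have hp : 0 < p :=
      pos_of_mul_pos_right (hq.trans_le hqp) (le_min (by positivity) (by positivity))
    rcases le_total t (1 / 2) with h | h
    · exact logMajorizedBy_spectralGeomMean hA hB ht h hq
        (hqp.trans (mul_le_mul_of_nonneg_right (min_le_left _ _) hp.le))
    -- For `t ≥ 1/2` the roles of `A` and `B` are exchanged and `1 - t ≤ 1/2` takes the place of
    -- `t`.
    · rw [spectralGeomMean_swap (hA.rpow q) (hB.rpow q),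
        spectralGeomMean_swap (hA.rpow p) (hB.rpow p)]
      refine logMajorizedBy_spectralGeomMean hB hA h1t (by linarith) hq ?_
      rw [sub_sub_cancel]
      exact hqp.trans (mul_le_mul_of_nonneg_right (min_le_right _ _) hp.le)
  · intro k p q hk hk2 hq hqp
    rw [spectralGeomMeanTilde_eq (hA.rpow q), spectralGeomMeanTilde_eq (hA.rpow p)]
    -- At `t = 1/2` one has `l = 2(1 - k)`, and the constant collapses to `2k`.
    refine logMajorizedBy_spectralMean hA hB hk hk2 (by norm_num) le_rfl hq (hqp.trans_eq ?_)
    have : (1 - k) ≠ 0 := by linarith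
    have h : 1 - 2 * k * (1 / 2) = 1 - k := by ring
    rw [h]
    field_simp
    ring
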